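/- **Conventions.** Let $\mathbb N=\{1,2,\dots\}$ and let $G$ be the group of all finite permutations of $\mathbb N$ (bijections moving only finitely many elements), with multiplication $gh=h\circ g$. A sequence $(F_n)$ of nonempty finite subsets of $G$ is a Følner sequence if $|KF_n\triangle F_n|/|F_n|\to0$ for every nonempty finite $K\subset G$. A set $A\subset G$ has Banach density $d$ if $\sup_{(F_n)}\limsup_n|F_n\cap A|/|F_n|=\inf_{(F_n)}\liminf_n|F_n\cap A|/|F_n|=d$, where $(F_n)$ ranges over all Følner sequences. For a continuous action of $G$ on a compact metrizable space $X$, the topological entropy is the supremum of the Kolmogorov–Sinai entropies $h(\mu)$ over all invariant Borel probability measures $\mu$; here $h(\mu)=\sup_{\mathcal P}h(\mu,\mathcal P)$ over finite measurable partitions, and $h(\mu,\mathcal P)=\lim_n\frac1{|F_n|}H(\mu,\bigvee_{g\in F_n}g^{-1}\mathcal P)$ for any Følner sequence $(F_n)$. A set $A\subset G$ is strongly deterministic if there are such a system $(X,G)$ of topological entropy zero, a continuous $\varphi:X\to\mathbb R$ and $x\in X$ with $\mathbf 1_A(g)=\varphi(g(x))$ for all $g\in G$. **Tilings.** For a finite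 collection $\mathcal S$ of finite subsets of $G$ containing the unit (shapes), a proper tiling with shapes $\mathcal S$ is a partition of $G$ into tiles $Sc$ with $S\in\mathcal S$ and $c\in G$, with a fixed choice of one shape $S$ and one center $c$ for each tile; it is identified with the point of $(\mathcal S\cup\{0\})^G$ whose value is $S$ at a center of a tile of shape $S$ and $0$ elsewhere. It is a monotiling if $|\mathcal S|=1$. $G$ acts on symbolic spaces by $g(x)(h)=x(hg)$. A dynamical tiling is a closed invariant set of proper tilings with the same collection of shapes, and a system of tilings is a closed, invariant subset $\boldsymbol{\mathsf T}$ of a product $\prod_k\mathsf T_k$ of dynamical tilings that projects onto each $\mathsf T_k$. It is *Følner* if the shapes of all the $\mathsf T_k$, enumerated in any order, form a Følner sequence. It is *uniquely congruent* if (i) for each $(\mathcal T_k)_k\in\boldsymbol{\mathsf T}$ and each $k$, every tile of $\mathcal T_{k+1}$ is a union of tiles of $\mathcal T_k$, and (ii) whenever $(\mathcal T_k)_k,(\mathcal T'_k)_k\in\boldsymbol{\mathsf T}$ and $S'c$, $S'c'$ are tiles of the same shape $S'$, with centers $c$ and $c'$, of $\mathcal T_{k+1}$ and $\mathcal T'_{k+1}$,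 then for each tile $T\subset S'c$ of $\mathcal T_k$ the set $Tc^{-1}c'$ is a tile of $\mathcal T'_k$. **Proposition.** For $k\ge2$ let $C_k=\{g\in G: g(1)<g(2)<\dots<g(k)\}$ and let $S_k$ be the set of all $g\in G$ with $g(n)=n$ for all $n>k$. 1. For every $k\ge2$, the set $C_k$ is strongly deterministic and has Banach density $\frac1{k!}$. 2. There is a system of monotilings $\boldsymbol{\mathsf T}$, indexed by $k\ge2$, with the single shape $S_k$ at level $k$, which is the orbit closure of an element $(\mathcal T_k)_{k\ge2}$ such that for each $k\ge2$ the set of centers of the monotiling $\mathcal T_k$ is $C_k$. The system $\boldsymbol{\mathsf T}$ is Følner, uniquely congruent, and has topological entropy zero. -/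

import Mathlib

open Filter Topology MeasureTheory
open scoped ENNReal Pointwise

noncomputable section

namespace Determinism

/-! ### Følner sequences and densities in a group -/

section Folner

variable {G : Type*} [Group G]

/-- A finite nonempty set `F` is `(K, ε)`-invariant if `|KF ∆ F| / |F| ≤ ε`. -/
def IsInvariantUnder (K : Finset G) (ε : ℝ) (F : Finset G) : Prop :=
  F.Nonempty ∧
    ((symmDiff ((K : Set G) * (F : Set G)) (F : Set G)).ncard : ℝ) / (F.card : ℝ) ≤ ε

/-- Følner sequences: eventually `(K, ε)`-invariant for all nonempty finite `K` and all `ε > 0`. -/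
def IsFolner (F : ℕ → Finset G) : Prop :=
  ∀ K : Finset G, K.Nonempty → ∀ ε : ℝ, 0 < ε → ∀ᶠ n in atTop, IsInvariantUnder K ε (F n)

/-- The proportion `|F ∩ A| / |F|`. -/
def proportion (F : Finset G) (A : Set G) : ℝ :=
  (((F : Set G) ∩ A).ncard : ℝ) / (F.card : ℝ)

/-- Upper Banach density: supremum over all Følner sequences of the upper densities. -/
def upperBanachDensity (A : Set G) : ℝ :=
  sSup {d : ℝ | ∃ F : ℕ → Finset G, IsFolner F ∧
    d = limsup (fun n => proportion (F n) A) atTop}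

/-- Lower Banach density: infimum over all Følner sequences of the lower densities. -/
def lowerBanachDensity (A : Set G) : ℝ :=
  sInf {d : ℝ | ∃ F : ℕ → Finset G, IsFolner F ∧
    d = liminf (fun n => proportion (F n) A) atTop}

/-- `A` has Banach density `d`: the upper and the lower Banach density both equal `d`. -/
def HasBanachDensity (A : Set G) (d : ℝ) : Prop :=
  upperBanachDensity A = d ∧ lowerBanachDensity A = d

end Folner

/-! ### Entropy -/

section Entropy

/-- Shannon entropy (base 2) of the finite partition of `X` into the level sets of
`P : X → ι`. -/
def shannonEntropy {X ι : Type*} [MeasurableSpace X] [Fintype ι] (μ : Measure X)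
    (P : X → ι) : ℝ :=
  -∑ i, μ.real (P ⁻¹' {i}) * Real.logb 2 (μ.real (P ⁻¹' {i}))

/-- The partition `P^F = ⋁_{g ∈ F} g⁻¹(P)`: the label of `x` is the family of the labels of
`g x`, `g ∈ F`. -/
def refine {G X ι : Type*} [Group G] [MulAction G X] (P : X → ι) (F : Finset G) :
    X → (F → ι) :=
  fun x g => P ((g : G) • x)

open scoped Classical in
/-- Dynamical entropy of a finite partition: the limit of `H(μ, P^{F_n}) / |F_n|` along Følner
sequences. As the limit exists and does not depend on the Følner sequence, it is written as the
supremum over all Følner sequences of the upper limits; in particular, it is zero iff the limit is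
zero along every Følner sequence. -/
def dynEntropy (G : Type*) {X ι : Type*} [Group G] [MulAction G X] [MeasurableSpace X]
    [Fintype ι] (μ : Measure X) (P : X → ι) : ℝ≥0∞ :=
  ⨆ (F : ℕ → Finset G) (_ : IsFolner F),
    limsup (fun n =>
      ENNReal.ofReal (shannonEntropy μ (refine P (F n)) / ((F n).card : ℝ))) atTop

/-- Kolmogorov--Sinai entropy: supremum over all finite measurable partitions. -/
def ksEntropy (G : Type*) {X : Type*} [Group G] [MulAction G X] [MeasurableSpace X]
    (μ : Measure X) : ℝ≥0∞ :=
  ⨆ (m : ℕ) (P : X → Fin m) (_ : Measurable P), dynEntropy G μ P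

/-- Topological entropy: supremum of the Kolmogorov--Sinai entropies over all invariant Borel
probability measures. -/
def topEntropy (G X : Type*) [Group G] [TopologicalSpace X] [MulAction G X] : ℝ≥0∞ :=
  letI : MeasurableSpace X := borel X
  ⨆ (μ : Measure X) (_ : IsProbabilityMeasure μ) (_ : SMulInvariantMeasure G X μ),
    ksEntropy G μ

end Entropy

/-! ### Strong determinism -/

/-- `f` is strongly deterministic if `f g = φ (g x)` for a continuous function `φ` and a point `x`
of a compact metrizable system of topological entropy zero. -/
def StronglyDeterministic {G : Type*} [Group G] (f : G → ℝ) : Prop :=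
  ∃ (X : Type) (_ : TopologicalSpace X) (_ : CompactSpace X)
    (_ : TopologicalSpace.MetrizableSpace X) (_ : MulAction G X) (_ : ContinuousConstSMul G X),
    topEntropy G X = 0 ∧
    ∃ (φ : X → ℝ) (x : X), Continuous φ ∧ ∀ g : G, f g = φ (g • x)

/-- A set is strongly deterministic if its indicator function is. -/
def StronglyDeterministicSet {G : Type*} [Group G] (A : Set G) : Prop :=
  StronglyDeterministic (A.indicator (fun _ => (1 : ℝ)))

/-! ### The full shift -/

/-- The symbolic space `A^G`. -/
def Shift (G A : Type*) : Type _ := G → A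

/-- Product topology, with the discrete topology on the alphabet. -/
instance (G A : Type*) : TopologicalSpace (Shift G A) :=
  @Pi.topologicalSpace G (fun _ => A) (fun _ => ⊥)

/-- The shift action `(g x)(h) = x (h g)`. -/
instance (G A : Type*) [Group G] : MulAction G (Shift G A) where
  smul g x := fun h => x (h * g)
  one_smul x := funext fun h => congrArg x (mul_one h)
  mul_smul g g' x := funext fun h => congrArg x (mul_assoc h g g').symm

/-! ### Tilings -/

section Tilings

variable {G : Type*} [Group G]

/-- The translate `S c`. -/
def translate (S : Set G) (c : G) : Set G := (fun s => s * c) '' S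

/-- Symbolic elements over the alphabet consisting of the shapes and one additional symbol (`none`,
the symbol "0"): `x c = some S` says that `c` is the center of a tile of shape `S`. -/
abbrev Symbolic (𝒮 : Finset (Finset G)) : Type _ := Shift G (Option 𝒮)

/-- The set of the centers of all tiles. -/
def centers {𝒮 : Finset (Finset G)} (x : Symbolic 𝒮) : Set G := {c | x c ≠ none}

/-- The collection of all tiles. -/
def tiles {𝒮 : Finset (Finset G)} (x : Symbolic 𝒮) : Set (Set G) :=
  {T | ∃ (c : G) (S : 𝒮), x c = some S ∧ T = translate (S : Finset G) c}

/-- `x` represents a proper tiling with collection of shapes `𝒮`: all shapes contain the unit, and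
the tiles `S c`, for `x c = some S`, partition `G`, each tile having only one center. -/
def IsProperTiling {𝒮 : Finset (Finset G)} (x : Symbolic 𝒮) : Prop :=
  (∀ S ∈ 𝒮, (1 : G) ∈ S) ∧
  ∀ g : G, ∃! c : G, ∃ S : 𝒮, x c = some S ∧ g ∈ translate ((S : Finset G) : Set G) c

/-- A dynamical tiling: a subshift all of whose elements represent proper tilings with collection
of shapes `𝒮`. -/
def IsDynamicalTiling {𝒮 : Finset (Finset G)} (Z : SubMulAction G (Symbolic 𝒮)) : Prop :=
  IsClosed (Z : Set (Symbolic 𝒮)) ∧ ∀ x ∈ Z, IsProperTiling x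

variable (G) in
/-- A system of tilings: a topological joining (a closed invariant subset of the product, with full
projections) of a sequence of dynamical tilings. -/
structure TilingSystem where
  /-- the collections of shapes -/
  shapes : ℕ → Finset (Finset G)
  /-- the dynamical tilings -/
  dyn : ∀ n, SubMulAction G (Symbolic (shapes n))
  isDynamicalTiling : ∀ n, IsDynamicalTiling (dyn n)
  /-- the joining -/
  space : SubMulAction G (∀ n, Symbolic (shapes n))
  isClosed_space : IsClosed (space : Set (∀ n, Symbolic (shapes n)))
  image_space : ∀ n, (fun x : ∀ n, Symbolic (shapes n) => x n) ''
    (space : Set (∀ n, Symbolic (shapes n))) = (dyn n : Set (Symbolic (shapes n)))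

namespace TilingSystem

variable (Θ : TilingSystem G)

/-- All the tilings are monotilings (there is one shape). -/
def IsMono : Prop := ∀ n, (Θ.shapes n).card = 1

/-- The shapes of all the dynamical tilings, taken in any order, form a Følner sequence. -/
def IsFolnerSystem : Prop :=
  {S : Finset G | ∃ n, S ∈ Θ.shapes n}.Infinite ∧
  ∀ F : ℕ → Finset G, Function.Injective F →
    Set.range F = {S : Finset G | ∃ n, S ∈ Θ.shapes n} → IsFolner F

/-- Every tile of the `(n+1)`st tiling is a union of tiles of the `n`th tiling. -/
def IsCongruent : Prop :=
  ∀ x ∈ Θ.space, ∀ n, ∀ T ∈ tiles (x (n + 1)), ∃ U ⊆ tiles (x n), T = ⋃₀ U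

/-- Congruent, and tiles of the same shape are partitioned the same way up to shifting: if `S' c` and
`S' c'` are tiles of the `(n+1)`st tilings of two elements `x` and `x'`, then each tile
`T` of `x n` inside `S' c` gives the tile `T c⁻¹ c'` of `x' n`. -/
def IsUniquelyCongruent : Prop :=
  Θ.IsCongruent ∧
  ∀ x ∈ Θ.space, ∀ x' ∈ Θ.space, ∀ n, ∀ (S' : Θ.shapes (n + 1)) (c c' : G),
    x (n + 1) c = some S' → x' (n + 1) c' = some S' →
    ∀ T ∈ tiles (x n), T ⊆ translate ((S' : Finset G) : Set G) c →
      translate T (c⁻¹ * c') ∈ tiles (x' n)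

end TilingSystem

end Tilings

/-! ### Finite permutations of the positive integers -/

/-- The permutations of `{1, 2, …}` that move only finitely many elements. -/
def finitePerms : Subgroup (Equiv.Perm ℕ+) where
  carrier := {g | {n | g n ≠ n}.Finite}
  one_mem' := by simp
  mul_mem' := by
    intro a b ha hb
    refine (ha.union hb).subset fun n hn => ?_
    by_contra h
    simp only [Set.mem_union, Set.mem_ofPred_eq, not_or, not_not] at h
    exact hn (by rw [Equiv.Perm.mul_apply, h.2, h.1])
  inv_mem' := by
    intro a ha
    refine Set.Finite.subset ha fun n hn h => hn ?_
    rw [Equiv.Perm.inv_eq_iff_eq, h]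

/-- The group of finite permutations of `{1, 2, …}`, with the composition in the reversed order,
`g h = h ∘ g`, as multiplication. -/
abbrev FinPerm : Type := finitePermsᵐᵒᵖ

/-- The permutation of `{1, 2, …}` underlying an element of the group. -/
def FinPerm.toPerm (g : FinPerm) : Equiv.Perm ℕ+ := (g.unop : Equiv.Perm ℕ+)

/-- `{g : g(1) < g(2) < ⋯ < g(k)}`. -/
def incrSet (k : ℕ) : Set FinPerm :=
  {g | ∀ i j : ℕ+, i < j → (j : ℕ) ≤ k → g.toPerm i < g.toPerm j}

/-- The permutations that fix all `n > k`. -/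
def symSet (k : ℕ) : Set FinPerm :=
  {g | ∀ n : ℕ+, k < (n : ℕ) → g.toPerm n = n}

end Determinism

end

noncomputable section

/-! In this group `g * h` is `h ∘ g`, so left multiplication by `s ∈ S_k` rearranges the list g(1),
…, g(k). Exactly one rearrangement is increasing: C_k meets every coset S_k g in one point
(`isCosetTransversal_incrSet`), so the S_k c with c ∈ C_k tile the group. A set F that is almost
S_k-invariant is almost the union S_k F of such cosets, so C_k has proportion about 1/k! in it
(`tendsto_proportion`).

The key is self-similarity (`mul_mem_incrSet_iff`): for k ≤ n, c ∈ C_n and s ∈ S_n, one has s c ∈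
C_k iff s ∈ C_k, because c is increasing on {1, …, n}, which s preserves. Hence every coset S_n c
with c ∈ C_n carries the same pattern of C_k, which is unique congruence. Moreover, the pattern of
C_k in a window S_N g is determined by the t ∈ S_N with g = t c, c ∈ C_N. There are at most N!
patterns on a window of N! elements, and log N! = o(N!). `exists_agree` carries all this to the
orbit closure.

Pattern counting handles only the clopen generators. Zero entropy extends from them because the sets
of zero entropy rate along the S_N form a σ-algebra (`HasZeroEntropyRate.of_generateFrom`), and from
the S_N to every Følner sequence by covering with cosets (`dynEntropy_eq_zero`). -/

namespace Determinism

/-! ### Shannon entropy of finite partitions -/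

section ShannonEntropy

/-- The inequality behind Gibbs' inequality. -/
lemma mul_log_sub_log_le {r q : ℝ} (hr : 0 ≤ r) (hq : 0 ≤ q) (h : q = 0 → r = 0) :
    r * (Real.log q - Real.log r) ≤ q - r := by
  rcases eq_or_lt_of_le hr with h0 | h0
  · simp [← h0, hq]
  · have hq0 : 0 < q := lt_of_le_of_ne hq fun h' => h0.ne' (h h'.symm)
    have := Real.log_le_sub_one_of_pos (div_pos hq0 h0)
    rw [Real.log_div hq0.ne' h0.ne'] at this
    calc _ ≤ r * (q / r - 1) := by gcongr
      _ = _ := by field_simp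

variable {X ι κ : Type*} [MeasurableSpace X] [Fintype ι] [Fintype κ]

/-- Shannon entropy in natural units. -/
def natEntropy (μ : Measure X) (P : X → ι) : ℝ :=
  ∑ i, Real.negMulLog (μ.real (P ⁻¹' {i}))

lemma shannonEntropy_eq (μ : Measure X) (P : X → ι) :
    shannonEntropy μ P = natEntropy μ P / Real.log 2 := by
  simp only [shannonEntropy, natEntropy, Real.negMulLog, Real.logb, Finset.sum_div,
    ← Finset.sum_neg_distrib]
  exact Finset.sum_congr rfl fun i _ => by ring

/-- All the preimages under `P` are measurable. -/
def IsMeasurablePartition {X ι : Type*} [MeasurableSpace X] (P : X → ι) : Prop :=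
  ∀ s : Set ι, MeasurableSet (P ⁻¹' s)

lemma IsMeasurablePartition.comp {X ι κ : Type*} [MeasurableSpace X] {P : X → ι}
    (hP : IsMeasurablePartition P) (f : ι → κ) : IsMeasurablePartition (f ∘ P) :=
  fun s => hP (f ⁻¹' s)

lemma isMeasurablePartition_of_singleton {X ι : Type*} [MeasurableSpace X] [Finite ι] {P : X → ι}
    (hP : ∀ i, MeasurableSet (P ⁻¹' {i})) : IsMeasurablePartition P := by
  intro s
  have : P ⁻¹' s = ⋃ i ∈ s, P ⁻¹' {i} := by ext; simp
  rw [this]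
  exact (Set.toFinite s).measurableSet_biUnion fun i _ => hP i

lemma IsMeasurablePartition.prodMk {X ι κ : Type*} [MeasurableSpace X] [Finite ι] [Finite κ]
    {P : X → ι} {Q : X → κ} (hP : IsMeasurablePartition P) (hQ : IsMeasurablePartition Q) :
    IsMeasurablePartition fun x => (P x, Q x) := by
  refine isMeasurablePartition_of_singleton fun i => ?_
  have : (fun x => (P x, Q x)) ⁻¹' {i} = P ⁻¹' {i.1} ∩ Q ⁻¹' {i.2} := by
    ext x; simp [Prod.ext_iff]
  rw [this]
  exact (hP _).inter (hQ _)

lemma isMeasurablePartition_pi {X ι α : Type*} [MeasurableSpace X] [Finite ι] [Finite α]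
    {P : α → X → ι} (hP : ∀ a, IsMeasurablePartition (P a)) :
    IsMeasurablePartition fun x a => P a x := by
  refine isMeasurablePartition_of_singleton fun i => ?_
  have : (fun x a => P a x) ⁻¹' {i} = ⋂ a, P a ⁻¹' {i a} := by
    ext x; simp [funext_iff]
  rw [this]
  exact MeasurableSet.iInter fun a => hP a _

variable {μ : Measure X}

lemma natEntropy_comp_smul {G : Type*} [Group G] [MulAction G X] [SMulInvariantMeasure G X μ]
    {P : X → ι} (hP : IsMeasurablePartition P) (g : G) :
    natEntropy μ (fun x => P (g • x)) = natEntropy μ P := by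
  refine Finset.sum_congr rfl fun i _ => ?_
  have := SMulInvariantMeasure.measure_preimage_smul (μ := μ) g (hP {i})
  rw [Measure.real, Measure.real, ← this]
  rfl

/-- For a probability measure the bound tends to 0 with the measure of `A`, which makes the
remainder in `HasZeroEntropyRate.iUnion` negligible. The term of `Aᶜ` is estimated by -r log r ≤ 1 -
r. -/
lemma natEntropy_mem_le (A : Set X) :
    natEntropy μ (fun x => x ∈ A) ≤ Real.negMulLog (μ.real A) + (1 - μ.real Aᶜ) := by
  classical
  have h1 : (fun x => x ∈ A) ⁻¹' {True} = A := by ext; simp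
  have h2 : (fun x => x ∈ A) ⁻¹' {False} = Aᶜ := by ext; simp
  have hn : natEntropy μ (fun x => x ∈ A) =
      Real.negMulLog (μ.real A) + Real.negMulLog (μ.real Aᶜ) := by
    rw [natEntropy, Fintype.sum_eq_add True False (by simp), h1, h2]
    intro p hp
    by_cases h : p <;> simp [h] at hp
  have := mul_log_sub_log_le (measureReal_nonneg (μ := μ) (s := Aᶜ)) zero_le_one (by simp)
  rw [hn, Real.negMulLog, Real.negMulLog]
  simp at this ⊢
  linarith

variable [IsProbabilityMeasure μ]

lemma sum_real_preimage {α : Type*} {P : X → α} (hP : IsMeasurablePartition P) (s : Finset α) :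
    ∑ i ∈ s, μ.real (P ⁻¹' {i}) = μ.real (P ⁻¹' s) :=
  sum_measureReal_preimage_singleton s fun i _ => hP {i}

lemma sum_univ_real_preimage {P : X → ι} (hP : IsMeasurablePartition P) :
    ∑ i, μ.real (P ⁻¹' {i}) = 1 := by
  rw [sum_real_preimage hP]; simp

lemma natEntropy_nonneg (P : X → ι) : 0 ≤ natEntropy μ P :=
  Finset.sum_nonneg fun _ _ => Real.negMulLog_nonneg measureReal_nonneg measureReal_le_one

/-- Each atom of `P` is no larger than the merged atom containing it, and the logarithm is monotone.
-/
lemma natEntropy_comp_le {P : X → ι} (hP : IsMeasurablePartition P) (f : ι → κ) :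
    natEntropy μ (f ∘ P) ≤ natEntropy μ P := by
  classical
  unfold natEntropy
  rw [← Finset.sum_fiberwise Finset.univ f]
  refine Finset.sum_le_sum fun k _ => ?_
  have hk : μ.real (f ∘ P ⁻¹' {k}) = ∑ i with f i = k, μ.real (P ⁻¹' {i}) := by
    rw [sum_real_preimage hP]
    congr 1
    ext x
    simp
  rw [Real.negMulLog, hk, ← Finset.sum_neg_distrib, Finset.sum_mul]
  refine Finset.sum_le_sum fun i hi => ?_
  rw [Real.negMulLog, ← hk]
  rcases eq_or_lt_of_le (measureReal_nonneg (μ := μ) (s := P ⁻¹' {i})) with h0 | h0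
  · simp [← h0]
  · have hle : μ.real (P ⁻¹' {i}) ≤ μ.real (f ∘ P ⁻¹' {k}) := by
      refine measureReal_mono ?_
      intro x hx
      simp only [Finset.mem_filter, Finset.mem_univ, true_and] at hi
      simp only [Set.mem_preimage, Set.mem_singleton_iff, Function.comp] at hx ⊢
      rw [hx, hi]
    nlinarith [Real.log_le_log h0 hle]

lemma natEntropy_le_of_factor {P : X → ι} {Q : X → κ} (hP : IsMeasurablePartition P)
    (f : ι → κ) (h : ∀ x, Q x = f (P x)) : natEntropy μ Q ≤ natEntropy μ P := by
  rw [show Q = f ∘ P from funext h]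
  exact natEntropy_comp_le hP f

lemma natEntropy_prodMk_le {P : X → ι} {Q : X → κ} (hP : IsMeasurablePartition P)
    (hQ : IsMeasurablePartition Q) :
    natEntropy μ (fun x => (P x, Q x)) ≤ natEntropy μ P + natEntropy μ Q := by
  classical
  set r : ι × κ → ℝ := fun z => μ.real ((fun x => (P x, Q x)) ⁻¹' {z}) with hr
  set p : ι → ℝ := fun i => μ.real (P ⁻¹' {i}) with hp
  set q : κ → ℝ := fun j => μ.real (Q ⁻¹' {j}) with hq
  have hPQ := hP.prodMk hQ
  have r0 : ∀ z, 0 ≤ r z := fun z => measureReal_nonneg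
  have rp : ∀ i, ∑ j, r (i, j) = p i := by
    intro i
    have := sum_real_preimage (μ := μ) hPQ (Finset.univ.image fun j : κ => (i, j))
    rw [Finset.sum_image fun _ _ _ _ h => (Prod.mk.inj h).2] at this
    rw [hr, this]
    congr 1
    ext x
    simp [eq_comm]
  have rq : ∀ j, ∑ i, r (i, j) = q j := by
    intro j
    have := sum_real_preimage (μ := μ) hPQ (Finset.univ.image fun i : ι => (i, j))
    rw [Finset.sum_image fun _ _ _ _ h => (Prod.mk.inj h).1] at this
    rw [hr, this]
    congr 1
    ext x
    simp [eq_comm]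
  -- Gibbs' inequality for the joint distribution against the product of its marginals.
  have key : ∑ z, r z * (Real.log (p z.1 * q z.2) - Real.log (r z)) ≤ 0 := by
    calc _ ≤ ∑ z : ι × κ, (p z.1 * q z.2 - r z) := by
            refine Finset.sum_le_sum fun z _ => mul_log_sub_log_le (r0 z)
              (mul_nonneg measureReal_nonneg measureReal_nonneg) fun h => ?_
            refine le_antisymm ?_ (r0 z)
            rcases mul_eq_zero.1 h with h | h
            · rw [← h]; exact measureReal_mono fun x hx => by
                simp only [Set.mem_preimage, Set.mem_singleton_iff] at hx ⊢; rw [← hx]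
            · rw [← h]; exact measureReal_mono fun x hx => by
                simp only [Set.mem_preimage, Set.mem_singleton_iff] at hx ⊢; rw [← hx]
      _ = 0 := by
            rw [Finset.sum_sub_distrib, sum_univ_real_preimage hPQ, Fintype.sum_prod_type,
              ← Finset.sum_mul_sum, sum_univ_real_preimage hP, sum_univ_real_preimage hQ]
            simp
  -- The logarithm of the product splits only for positive marginals. If `r z = 0`, both sides
  -- vanish; otherwise `r z` bounds both marginals from below.
  have hsplit : ∀ z : ι × κ, r z * (Real.log (p z.1 * q z.2) - Real.log (r z)) =
      r z * Real.log (p z.1) + r z * Real.log (q z.2) + Real.negMulLog (r z) := by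
    intro z
    rcases eq_or_lt_of_le (r0 z) with h0 | h0
    · simp [← h0]
    · have h1 : r z ≤ p z.1 := measureReal_mono fun x hx => by
        simp only [Set.mem_preimage, Set.mem_singleton_iff] at hx ⊢; rw [← hx]
      have h2 : r z ≤ q z.2 := measureReal_mono fun x hx => by
        simp only [Set.mem_preimage, Set.mem_singleton_iff] at hx ⊢; rw [← hx]
      rw [Real.log_mul (by linarith) (by linarith), Real.negMulLog]
      ring
  simp only [hsplit, Finset.sum_add_distrib] at key
  have h1 : ∑ z : ι × κ, r z * Real.log (p z.1) = -natEntropy μ P := by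
    rw [Fintype.sum_prod_type, natEntropy, ← Finset.sum_neg_distrib]
    refine Finset.sum_congr rfl fun i _ => ?_
    simp only [← Finset.sum_mul, rp, Real.negMulLog, hp]
    ring
  have h2 : ∑ z : ι × κ, r z * Real.log (q z.2) = -natEntropy μ Q := by
    rw [Fintype.sum_prod_type_right, natEntropy, ← Finset.sum_neg_distrib]
    refine Finset.sum_congr rfl fun i _ => ?_
    simp only [← Finset.sum_mul, rq, Real.negMulLog, hq]
    ring
  rw [h1, h2] at key
  have : natEntropy μ (fun x => (P x, Q x)) = ∑ z, Real.negMulLog (r z) := rfl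
  linarith

lemma natEntropy_le_log_card {P : X → ι} (hP : IsMeasurablePartition P) (V : Finset ι)
    (hV : ∀ x, P x ∈ V) : natEntropy μ P ≤ Real.log V.card := by
  classical
  have hsum : ∑ i ∈ V, μ.real (P ⁻¹' {i}) = 1 := by
    rw [sum_real_preimage hP, show P ⁻¹' (V : Set ι) = Set.univ from
      Set.eq_univ_of_forall fun x => hV x]
    simp
  have hV0 : (0 : ℝ) < V.card := by
    rcases V.eq_empty_or_nonempty with h | h
    · simp [h] at hsum
    · exact_mod_cast h.card_pos
  have hnat : natEntropy μ P = ∑ i ∈ V, Real.negMulLog (μ.real (P ⁻¹' {i})) := by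
    refine (Finset.sum_subset (Finset.subset_univ _) fun i _ hi => ?_).symm
    have : P ⁻¹' {i} = ∅ := Set.eq_empty_of_forall_notMem fun x hx => hi (by
      simp only [Set.mem_preimage, Set.mem_singleton_iff] at hx; exact hx ▸ hV x)
    simp [this]
  -- Gibbs' inequality against the uniform distribution on `V`.
  have key : ∑ i ∈ V, μ.real (P ⁻¹' {i}) *
      (Real.log (1 / V.card) - Real.log (μ.real (P ⁻¹' {i}))) ≤ 0 := by
    calc _ ≤ ∑ i ∈ V, (1 / (V.card : ℝ) - μ.real (P ⁻¹' {i})) :=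
          Finset.sum_le_sum fun i _ => mul_log_sub_log_le measureReal_nonneg (by positivity)
            fun h => absurd h (by positivity)
      _ = 0 := by
          rw [Finset.sum_sub_distrib, hsum, Finset.sum_const, nsmul_eq_mul]
          field_simp
          simp
  simp only [mul_sub, Finset.sum_sub_distrib, ← Finset.sum_mul, hsum, one_div, Real.log_inv]
    at key
  rw [hnat]
  simp only [Real.negMulLog, neg_mul, Finset.sum_neg_distrib]
  linarith

end ShannonEntropy

/-! ### Saturation by cosets of a finite subgroup -/

section Cosets

variable {G : Type*} [Group G]

/-- Every right coset `H g` contains exactly one element of `C`. -/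
def IsCosetTransversal (H : Subgroup G) (C : Set G) : Prop :=
  ∀ g : G, ∃! c : G, c ∈ C ∧ ∃ s ∈ H, g = s * c

open scoped Classical in
-- `S * F` is invariant under left multiplication by `H`, so it is a disjoint union of right cosets,
-- and the representative in `C` of each of them lies in `S * F` too.
lemma exists_transversal_decomposition {H : Subgroup G} {C : Set G} (hC : IsCosetTransversal H C)
    {S : Finset G} (hS : (S : Set G) = H) (F : Finset G) :
    ∃ T : Finset G, (∀ c, c ∈ T ↔ c ∈ S * F ∧ c ∈ C) ∧
      S * F = T.biUnion (fun c => S.image (· * c)) ∧ (S * F).card = T.card * S.card := by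
  have memS : ∀ s, s ∈ S ↔ s ∈ H := fun s => by
    rw [← Finset.mem_coe, hS]; rfl
  have hT : S * F = ((S * F).filter (· ∈ C)).biUnion (fun c => S.image (· * c)) := by
    ext g
    simp only [Finset.mem_biUnion, Finset.mem_filter, Finset.mem_image]
    constructor
    · intro hg
      obtain ⟨c, ⟨hc, s, hs, rfl⟩, -⟩ := hC g
      obtain ⟨t, ht, f, hf, h⟩ := Finset.mem_mul.1 hg
      refine ⟨c, ⟨Finset.mem_mul.2 ⟨s⁻¹ * t, ?_, f, hf, ?_⟩, hc⟩, s, (memS s).2 hs, rfl⟩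
      · exact (memS _).2 (H.mul_mem (H.inv_mem hs) ((memS t).1 ht))
      · rw [mul_assoc, h, inv_mul_cancel_left]
    · rintro ⟨c, ⟨hc, -⟩, s, hs, rfl⟩
      obtain ⟨t, ht, f, hf, rfl⟩ := Finset.mem_mul.1 hc
      exact Finset.mem_mul.2 ⟨s * t, (memS _).2 (H.mul_mem ((memS s).1 hs) ((memS t).1 ht)), f, hf,
        mul_assoc _ _ _⟩
  refine ⟨(S * F).filter (· ∈ C), fun c => Finset.mem_filter, hT, ?_⟩
  conv_lhs => rw [hT]
  rw [Finset.card_biUnion, Finset.sum_congr rfl fun c _ =>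
    Finset.card_image_of_injective S (mul_left_injective c), Finset.sum_const, smul_eq_mul]
  intro c hc d hd hcd
  rw [Function.onFun, Finset.disjoint_left]
  rintro g hg hg'
  obtain ⟨s, hs, rfl⟩ := Finset.mem_image.1 hg
  obtain ⟨t, ht, h⟩ := Finset.mem_image.1 hg'
  exact hcd ((hC (s * c)).unique ⟨(Finset.mem_filter.1 hc).2, s, (memS s).1 hs, rfl⟩
    ⟨(Finset.mem_filter.1 hd).2, t, (memS t).1 ht, h.symm⟩)

open scoped Classical in
lemma IsInvariantUnder.card_mul_le {S F : Finset G} {ε : ℝ} (h : IsInvariantUnder S ε F)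
    (h1 : 1 ∈ S) : F ⊆ S * F ∧ ((S * F).card : ℝ) - F.card ≤ ε * F.card := by
  have hsub : F ⊆ S * F := fun f hf => Finset.mem_mul.2 ⟨1, h1, f, hf, one_mul f⟩
  refine ⟨hsub, ?_⟩
  have hpos : (0 : ℝ) < F.card := by exact_mod_cast h.1.card_pos
  have h2 := (div_le_iff₀ hpos).1 h.2
  have h3 : symmDiff ((S : Set G) * (F : Set G)) (F : Set G) = ((S * F) \ F : Finset G) := by
    rw [← Finset.coe_mul, symmDiff_def, Finset.coe_sdiff]
    have : (F : Set G) \ ((S * F : Finset G) : Set G) = ∅ :=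
      Set.sdiff_eq_empty.2 (Finset.coe_subset.2 hsub)
    rw [this]
    exact Set.union_empty _
  rw [h3, Set.ncard_coe_finset, Finset.card_sdiff_of_subset hsub,
    Nat.cast_sub (Finset.card_le_card hsub)] at h2
  exact h2

lemma tendsto_proportion {H : Subgroup G} {C : Set G} (hC : IsCosetTransversal H C)
    {S : Finset G} (hS : (S : Set G) = H) {F : ℕ → Finset G} (hF : IsFolner F) :
    Tendsto (fun n => proportion (F n) C) atTop (𝓝 (1 / (S.card : ℝ))) := by
  classical
  have h1 : (1 : G) ∈ S := by rw [← Finset.mem_coe, hS]; exact H.one_mem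
  rw [Metric.tendsto_atTop']
  intro ε hε
  -- With |SF \ F| ≤ (ε/2)|F|, the count |F ∩ C| differs from |F|/|S| by at most (ε/2)|F| in either
  -- direction; halving ε makes the final inequalities strict.
  obtain ⟨N, hN⟩ := eventually_atTop.1 (hF S ⟨1, h1⟩ (ε / 2) (by positivity))
  refine ⟨N, fun n hn => ?_⟩
  have hinv := hN n hn.le
  obtain ⟨hsub, hcard⟩ := hinv.card_mul_le h1
  obtain ⟨T, hT, -, hTcard⟩ := exists_transversal_decomposition hC hS (F n)
  set f : ℝ := ((F n).card : ℝ) with hf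
  have hfpos : 0 < f := by rw [hf]; exact_mod_cast hinv.1.card_pos
  have hspos : (1 : ℝ) ≤ S.card := by exact_mod_cast Finset.card_pos.2 ⟨1, h1⟩
  have hcoe : ((F n : Set G) ∩ C) = ((F n).filter (· ∈ C) : Finset G) := by ext; simp
  have hle : ((F n).filter (· ∈ C)).card ≤ T.card := Finset.card_le_card fun c hc => by
    rw [Finset.mem_filter] at hc
    exact (hT c).2 ⟨hsub hc.1, hc.2⟩
  have hge : T.card ≤ ((F n).filter (· ∈ C)).card + ((S * F n) \ F n).card := by
    refine (Finset.card_le_card fun c hc => ?_).trans (Finset.card_union_le _ _)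
    have := (hT c).1 hc
    by_cases h : c ∈ F n
    · exact Finset.mem_union_left _ (Finset.mem_filter.2 ⟨h, this.2⟩)
    · exact Finset.mem_union_right _ (Finset.mem_sdiff.2 ⟨this.1, h⟩)
  have hge' : (T.card : ℝ) ≤ ((F n).filter (· ∈ C)).card + (((S * F n).card : ℝ) - f) := by
    rw [Finset.card_sdiff_of_subset hsub] at hge
    rw [← Nat.cast_sub (Finset.card_le_card hsub)]
    exact_mod_cast hge
  have hle' : (((F n).filter (· ∈ C)).card : ℝ) ≤ T.card := by exact_mod_cast hle
  have hTc : (T.card : ℝ) = (S * F n).card / S.card := by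
    rw [hTcard]; push_cast; field_simp
  have hsubr : f ≤ (S * F n).card := by rw [hf]; exact_mod_cast Finset.card_le_card hsub
  have hlow : f / S.card ≤ T.card := by rw [hTc]; gcongr
  have hupp : (T.card : ℝ) ≤ f / S.card + ε / 2 * f := by
    calc (T.card : ℝ) = f / S.card + ((S * F n).card - f) / S.card := by rw [hTc]; ring
      _ ≤ f / S.card + ((S * F n).card - f) := by
        gcongr; exact div_le_self (by linarith) hspos
      _ ≤ _ := by linarith
  rw [proportion, hcoe, Set.ncard_coe_finset, Real.dist_eq, abs_lt]
  have hdiv : (((F n).filter (· ∈ C)).card : ℝ) / f - 1 / S.card =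
      (((F n).filter (· ∈ C)).card - f / S.card) / f := by field_simp
  rw [← hf, hdiv, lt_div_iff₀ hfpos, div_lt_iff₀ hfpos]
  constructor <;> nlinarith [mul_pos hε hfpos]

/-- The proportions converge to the same limit along every Følner sequence, so both sets of
densities are singletons. The given `F` shows that they are nonempty; `sSup` and `sInf` of the empty
set would be 0. -/
lemma hasBanachDensity_of_transversal {H : Subgroup G} {C : Set G} (hC : IsCosetTransversal H C)
    {S : Finset G} (hS : (S : Set G) = H) {F : ℕ → Finset G} (hF : IsFolner F) :
    HasBanachDensity C (1 / (S.card : ℝ)) := by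
  constructor
  · have h : {d : ℝ | ∃ F : ℕ → Finset G, IsFolner F ∧
        d = limsup (fun n => proportion (F n) C) atTop} = {1 / (S.card : ℝ)} := by
      ext d
      simp only [Set.mem_ofPred_eq, Set.mem_singleton_iff]
      constructor
      · rintro ⟨F, hF, rfl⟩
        exact (tendsto_proportion hC hS hF).limsup_eq
      · rintro rfl
        exact ⟨F, hF, (tendsto_proportion hC hS hF).limsup_eq.symm⟩
    rw [upperBanachDensity, h, csSup_singleton]
  · have h : {d : ℝ | ∃ F : ℕ → Finset G, IsFolner F ∧
        d = liminf (fun n => proportion (F n) C) atTop} = {1 / (S.card : ℝ)} := by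
      ext d
      simp only [Set.mem_ofPred_eq, Set.mem_singleton_iff]
      constructor
      · rintro ⟨F, hF, rfl⟩
        exact (tendsto_proportion hC hS hF).liminf_eq
      · rintro rfl
        exact ⟨F, hF, (tendsto_proportion hC hS hF).liminf_eq.symm⟩
    rw [lowerBanachDensity, h, csInf_singleton]

end Cosets

/-! ### Entropy of the refinements of a partition -/

section Refine

variable {G X ι κ : Type*} [Group G] [MulAction G X] [MeasurableSpace X] [Fintype ι] [Fintype κ]

open scoped Classical in
/-- The entropy of `P^F` in natural units. -/
def refineEntropy (μ : Measure X) (P : X → ι) (F : Finset G) : ℝ :=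
  natEntropy μ (refine P F)

lemma refineEntropy_nonneg {μ : Measure X} [IsProbabilityMeasure μ] (P : X → ι) (F : Finset G) : 0 ≤ refineEntropy μ P F := by
  classical
  rw [refineEntropy]
  exact natEntropy_nonneg _

variable [MeasurableConstSMul G X]

lemma IsMeasurablePartition.refine {ι : Type*} [Finite ι] {P : X → ι}
    (hP : IsMeasurablePartition P) (F : Finset G) :
    IsMeasurablePartition (refine P F) :=
  isMeasurablePartition_pi fun g s => measurable_const_smul (g : G) (hP s)

variable {μ : Measure X} [IsProbabilityMeasure μ]

lemma refineEntropy_le_log_card {P : X → ι} (hP : IsMeasurablePartition P) (F : Finset G)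
    (V : Finset (F → ι)) (hV : ∀ x, refine P F x ∈ V) :
    refineEntropy μ P F ≤ Real.log V.card := by
  classical
  exact natEntropy_le_log_card (hP.refine F) V hV

lemma refineEntropy_mono {P : X → ι} (hP : IsMeasurablePartition P) {F F' : Finset G}
    (h : F ⊆ F') : refineEntropy μ P F ≤ refineEntropy μ P F' := by
  classical
  exact natEntropy_le_of_factor (hP.refine F') (fun y g => y ⟨g, h g.2⟩) fun _ => rfl

lemma refineEntropy_empty {P : X → ι} (hP : IsMeasurablePartition P) :
    refineEntropy μ P (∅ : Finset G) ≤ 0 := by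
  classical
  have := refineEntropy_le_log_card (μ := μ) hP (∅ : Finset G) {fun g => absurd g.2 (Finset.notMem_empty _)}
    fun x => by rw [Finset.mem_singleton]; ext g; exact absurd g.2 (Finset.notMem_empty _)
  simpa using this

open scoped Classical in
lemma refineEntropy_union_le {P : X → ι} (hP : IsMeasurablePartition P) (F F' : Finset G) :
    refineEntropy μ P (F ∪ F') ≤ refineEntropy μ P F + refineEntropy μ P F' := by
  refine le_trans (natEntropy_le_of_factor ((hP.refine F).prodMk (hP.refine F'))
    (fun y g => if h : (g : G) ∈ F then y.1 ⟨g, h⟩ else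
      y.2 ⟨g, (Finset.mem_union.1 g.2).resolve_left h⟩) fun x => ?_)
    (natEntropy_prodMk_le (hP.refine F) (hP.refine F'))
  ext g
  by_cases h : (g : G) ∈ F <;> simp [h, Determinism.refine]

open scoped Classical in
lemma refineEntropy_biUnion_le {P : X → ι} (hP : IsMeasurablePartition P) (T : Finset G)
    (B : G → Finset G) :
    refineEntropy μ P (T.biUnion B) ≤ ∑ t ∈ T, refineEntropy μ P (B t) := by
  induction T using Finset.induction_on with
  | empty => simpa using refineEntropy_empty hP
  | insert a T ha ih =>
    rw [Finset.biUnion_insert, Finset.sum_insert ha]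
    linarith [refineEntropy_union_le (μ := μ) hP (B a) (T.biUnion B)]

lemma refineEntropy_le_of_factor_prod {ν : Type*} [Fintype ν] {P : X → ι} {Q : X → κ} {R : X → ν}
    (hP : IsMeasurablePartition P) (hQ : IsMeasurablePartition Q) (f : ι → κ → ν)
    (h : ∀ x, R x = f (P x) (Q x)) (F : Finset G) :
    refineEntropy μ R F ≤ refineEntropy μ P F + refineEntropy μ Q F := by
  classical
  refine le_trans (natEntropy_le_of_factor ((hP.refine F).prodMk (hQ.refine F))
    (fun y g => f (y.1 g) (y.2 g)) fun x => ?_)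
    (natEntropy_prodMk_le (hP.refine F) (hQ.refine F))
  ext g
  exact h _

lemma refineEntropy_le_of_factor {P : X → ι} {Q : X → κ}
    (hP : IsMeasurablePartition P) (f : ι → κ) (h : ∀ x, Q x = f (P x)) (F : Finset G) :
    refineEntropy μ Q F ≤ refineEntropy μ P F := by
  classical
  exact natEntropy_le_of_factor (hP.refine F) (fun y g => f (y g)) fun x => funext fun g => h _

variable [SMulInvariantMeasure G X μ]

open scoped Classical in
-- Since (s c) • x = s • (c • x), the labels of `x` over `S c` are those of `c • x` over `S`, and
-- `μ` is invariant.
lemma refineEntropy_image_mul_right_le {P : X → ι} (hP : IsMeasurablePartition P)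
    (S : Finset G) (c : G) :
    refineEntropy μ P (S.image (· * c)) ≤ refineEntropy μ P S := by
  have hm : ∀ g : (S.image (· * c) : Finset G), (g : G) * c⁻¹ ∈ S := by
    rintro ⟨g, hg⟩
    obtain ⟨s, hs, rfl⟩ := Finset.mem_image.1 hg
    simpa using hs
  calc refineEntropy μ P (S.image (· * c))
      ≤ natEntropy μ (fun x => refine P S (c • x)) := by
        refine natEntropy_le_of_factor
          (fun s => measurable_const_smul c ((hP.refine S) s))
          (fun y g => y ⟨_, hm g⟩) fun x => ?_
        ext g
        simp [Determinism.refine, smul_smul]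
    _ = refineEntropy μ P S := natEntropy_comp_smul (hP.refine S) c

lemma refineEntropy_le_card_mul {P : X → ι} (hP : IsMeasurablePartition P) (F : Finset G) :
    refineEntropy μ P F ≤ F.card * natEntropy μ P := by
  classical
  have h := refineEntropy_biUnion_le (μ := μ) hP F fun g => {g}
  rw [Finset.biUnion_singleton_eq_self] at h
  refine h.trans ?_
  rw [← nsmul_eq_mul]
  refine Finset.sum_le_card_nsmul _ _ _ fun g _ => ?_
  rw [← natEntropy_comp_smul hP g]
  refine natEntropy_le_of_factor (fun s => measurable_const_smul g (hP s))
    (fun y _ => y) fun x => ?_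
  ext ⟨a, ha⟩
  rw [Finset.mem_singleton] at ha
  subst ha
  rfl

end Refine

/-! ### Partitions of entropy zero -/

section ZeroEntropy

variable {G X : Type*} [Group G] [MulAction G X] [MeasurableSpace X]

/-- The entropy of `P^{S_n}` is `o(|S_n|)`. -/
def HasZeroEntropyRate (μ : Measure X) (S : ℕ → Finset G) {ι : Type*} [Fintype ι] (P : X → ι) :
    Prop :=
  ∀ ε : ℝ, 0 < ε → ∀ᶠ n in atTop, refineEntropy μ P (S n) ≤ ε * (S n).card

variable [MeasurableConstSMul G X] {μ : Measure X} [IsProbabilityMeasure μ]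

lemma HasZeroEntropyRate.factor_prod {S : ℕ → Finset G} {ι κ ν : Type*} [Fintype ι] [Fintype κ]
    [Fintype ν] {P : X → ι} {Q : X → κ} {R : X → ν}
    (zP : HasZeroEntropyRate μ S P) (zQ : HasZeroEntropyRate μ S Q)
    (hP : IsMeasurablePartition P) (hQ : IsMeasurablePartition Q) (f : ι → κ → ν)
    (h : ∀ x, R x = f (P x) (Q x)) : HasZeroEntropyRate μ S R := by
  intro ε hε
  filter_upwards [zP (ε / 2) (by positivity), zQ (ε / 2) (by positivity)] with n h1 h2
  linarith [refineEntropy_le_of_factor_prod (μ := μ) hP hQ f h (S n)]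

lemma HasZeroEntropyRate.of_constant {S : ℕ → Finset G} {ι : Type*} [Fintype ι] (i : ι) :
    HasZeroEntropyRate μ S (fun _ : X => i) := by
  intro ε hε
  refine Eventually.of_forall fun n => le_trans ?_ (by positivity : 0 ≤ ε * (S n).card)
  classical
  have hm : IsMeasurablePartition (fun _ : X => i) := fun s => by
    by_cases h : i ∈ s <;> simp [h]
  simpa using refineEntropy_le_log_card (μ := μ) hm (S n) {fun _ => i} fun x => by
    simp [refine, funext_iff]

lemma isMeasurablePartition_mem {X : Type*} [MeasurableSpace X] {A : Set X} (hA : MeasurableSet A) :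
    IsMeasurablePartition (fun x => x ∈ A) := by
  refine isMeasurablePartition_of_singleton fun p => ?_
  by_cases h : p
  · convert hA; ext x; simp [h]
  · convert hA.compl; ext x; simp [h]

/-- Partitions all of whose two-set coarsenings have entropy rate zero. -/
lemma HasZeroEntropyRate.of_mem {S : ℕ → Finset G} {ι : Type*} [Fintype ι] {P : X → ι}
    (hP : IsMeasurablePartition P) (h : ∀ i, HasZeroEntropyRate μ S (fun x => x ∈ P ⁻¹' {i})) :
    HasZeroEntropyRate μ S P := by
  classical
  -- Labels are revealed one at a time, those outside `T` being merged into `none`.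
  have key : ∀ T : Finset ι, HasZeroEntropyRate μ S
      (fun x => if P x ∈ T then some (P x) else none) := by
    intro T
    induction T using Finset.induction_on with
    | empty => simpa using HasZeroEntropyRate.of_constant (none : Option ι)
    | insert a T _ ih =>
      refine ih.factor_prod (h a) (hP.comp fun i => if i ∈ T then some i else none)
        (isMeasurablePartition_mem (hP _)) (fun o b => if b then some a else o) fun x => ?_
      by_cases hx : P x = a
      · simp [hx]
      · simp [hx]
  intro ε hε
  filter_upwards [key Finset.univ ε hε] with n hn
  rcases isEmpty_or_nonempty X with hX | ⟨⟨x⟩⟩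
  · have h0 : μ Set.univ = 1 := measure_univ
    rw [Set.eq_empty_of_isEmpty Set.univ] at h0
    simp at h0
  · refine le_trans (refineEntropy_le_of_factor
      (hP.comp fun i => if i ∈ Finset.univ then some i else none) (fun o => o.getD (P x))
      (fun y => ?_) _) hn
    simp

variable [SMulInvariantMeasure G X μ]

/-- The union is a finite partial union, of rate zero, together with a remainder of small measure.
The remainder costs at most its one-step entropy per group element, uniformly in `n`. -/
lemma HasZeroEntropyRate.iUnion {S : ℕ → Finset G} {A : ℕ → Set X}
    (hA : ∀ i, MeasurableSet (A i)) (h : ∀ i, HasZeroEntropyRate μ S (fun x => x ∈ A i)) :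
    HasZeroEntropyRate μ S (fun x => x ∈ ⋃ i, A i) := by
  have hBm : ∀ n, MeasurableSet (Set.accumulate A n) := fun n => by
    rw [Set.accumulate_def]
    exact MeasurableSet.biUnion (Set.to_countable _) fun i _ => hA i
  have hB : ∀ n, HasZeroEntropyRate μ S (fun x => x ∈ Set.accumulate A n) := by
    intro n
    induction n with
    | zero => simpa [Set.accumulate_def] using h 0
    | succ n ih =>
      refine ih.factor_prod (h (n + 1)) (isMeasurablePartition_mem (hBm n))
        (isMeasurablePartition_mem (hA _)) Or fun x => ?_
      rw [Set.accumulate_succ]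
      rfl
  have hU : MeasurableSet (⋃ i, A i) := MeasurableSet.iUnion hA
  have hlim : Tendsto (fun n => μ.real ((⋃ i, A i) \ Set.accumulate A n)) atTop (𝓝 0) := by
    have h1 := (ENNReal.tendsto_toReal (measure_ne_top μ (⋃ i, A i))).comp
      (tendsto_measure_iUnion_accumulate (μ := μ) (f := A))
    have h2 := h1.const_sub (μ.real (⋃ i, A i))
    rw [Measure.real, sub_self] at h2
    refine h2.congr fun n => ?_
    rw [measureReal_sdiff ?_ (hBm n)]
    · rfl
    · exact Set.accumulate_subset_iUnion n
  have hlim' : Tendsto (fun n => natEntropy μ (fun x => x ∈ (⋃ i, A i) \ Set.accumulate A n))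
      atTop (𝓝 0) := by
    refine squeeze_zero (fun n => natEntropy_nonneg _) (fun n => natEntropy_mem_le _) ?_
    have h1 := (Real.continuous_negMulLog.tendsto 0).comp hlim
    rw [Real.negMulLog_zero] at h1
    have h2 := h1.add hlim
    rw [add_zero] at h2
    refine h2.congr fun n => ?_
    rw [probReal_compl_eq_one_sub (hU.diff (hBm n)), sub_sub_cancel]
    rfl
  intro ε hε
  obtain ⟨N, hN⟩ := ((tendsto_order.1 hlim').2 (ε / 2) (by positivity)).exists
  filter_upwards [hB N (ε / 2) (by positivity)] with n hn
  have h1 := refineEntropy_le_of_factor_prod (μ := μ) (R := fun x => x ∈ ⋃ i, A i)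
    (isMeasurablePartition_mem (hBm N))
    (isMeasurablePartition_mem (hU.diff (hBm N))) Or (fun x => ?_) (S n)
  · have h2 := refineEntropy_le_card_mul (μ := μ) (isMeasurablePartition_mem (hU.diff (hBm N)))
      (S n)
    nlinarith [Nat.cast_nonneg (α := ℝ) (S n).card]
  · have : (⋃ i, A i) = Set.accumulate A N ∪ ((⋃ i, A i) \ Set.accumulate A N) :=
      (Set.union_sdiff_cancel (Set.accumulate_subset_iUnion N)).symm
    conv_lhs => rw [this]
    rfl

lemma HasZeroEntropyRate.of_generateFrom {S : ℕ → Finset G} {C : Set (Set X)}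
    (hC : ‹MeasurableSpace X› = MeasurableSpace.generateFrom C)
    (h : ∀ A ∈ C, HasZeroEntropyRate μ S (fun x => x ∈ A)) {A : Set X} (hA : MeasurableSet A) :
    HasZeroEntropyRate μ S (fun x => x ∈ A) := by
  rw [hC] at hA
  refine MeasurableSpace.generateFrom_induction C
    (fun A _ => HasZeroEntropyRate μ S (fun x => x ∈ A)) (fun A hA _ => h A hA)
    ?_ ?_ ?_ A hA
  · simpa using HasZeroEntropyRate.of_constant (μ := μ) (S := S) False
  · intro A hA ih ε hε
    filter_upwards [ih ε hε] with n hn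
    rw [← hC] at hA
    exact (refineEntropy_le_of_factor (isMeasurablePartition_mem hA) Not (fun _ => rfl) _).trans hn
  · intro A hA ih
    rw [← hC] at hA
    exact HasZeroEntropyRate.iUnion hA ih

lemma dynEntropy_eq_zero {H : ℕ → Subgroup G} {C : ℕ → Set G}
    (hC : ∀ n, IsCosetTransversal (H n) (C n)) {S : ℕ → Finset G}
    (hS : ∀ n, (S n : Set G) = H n) {ι : Type*} [Fintype ι] {P : X → ι}
    (hP : IsMeasurablePartition P) (h : HasZeroEntropyRate μ S P) : dynEntropy G μ P = 0 := by
  classical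
  rw [dynEntropy]
  simp only [ENNReal.iSup_eq_zero]
  intro F hF
  have hlim : Tendsto (fun n => refineEntropy μ P (F n) / (F n).card) atTop (𝓝 0) := by
    refine tendsto_order.2 ⟨fun a ha => Eventually.of_forall fun n => ha.trans_le
      (div_nonneg (refineEntropy_nonneg _ _) (by positivity)), fun ε hε => ?_⟩
    -- A single `S n` suffices. Invariance with constant 1 gives |S_n F| ≤ 2|F|, and the translates
    -- of `S n` tiling S_n F cost at most ε/3 per element, in total (2/3)ε|F|.
    obtain ⟨n, hn⟩ := (h (ε / 3) (by positivity)).exists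
    have h1 : (1 : G) ∈ S n := by rw [← Finset.mem_coe, hS]; exact (H n).one_mem
    filter_upwards [hF (S n) ⟨1, h1⟩ 1 one_pos] with m hm
    obtain ⟨hsub, hcard⟩ := hm.card_mul_le h1
    obtain ⟨T, -, hT, hTcard⟩ := exists_transversal_decomposition (hC n) (hS n) (F m)
    have hpos : (0 : ℝ) < (F m).card := by exact_mod_cast hm.1.card_pos
    rw [div_lt_iff₀ hpos]
    calc refineEntropy μ P (F m) ≤ refineEntropy μ P (S n * F m) := refineEntropy_mono hP hsub
      _ ≤ ∑ c ∈ T, refineEntropy μ P ((S n).image (· * c)) := by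
        rw [hT]; exact refineEntropy_biUnion_le hP _ _
      _ ≤ T.card • (ε / 3 * (S n).card) := Finset.sum_le_card_nsmul _ _ _ fun c _ =>
        (refineEntropy_image_mul_right_le hP _ _).trans hn
      _ = ε / 3 * (S n * F m).card := by rw [hTcard]; push_cast; rw [nsmul_eq_mul]; ring
      _ < ε * (F m).card := by nlinarith
  have hlim2 : Tendsto (fun n => ENNReal.ofReal
      (refineEntropy μ P (F n) / (F n).card / Real.log 2)) atTop (𝓝 0) := by
    simpa using ENNReal.tendsto_ofReal (hlim.div_const (Real.log 2))
  rw [← hlim2.limsup_eq]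
  congr 1
  ext n
  rw [shannonEntropy_eq, div_right_comm]
  rfl

end ZeroEntropy

/-- A continuous action has topological entropy zero if, for a family of sets generating the Borel
sets and a sequence of finite subgroups, the entropy rates along the subgroups vanish. -/
theorem topEntropy_eq_zero {G X : Type*} [Group G] [TopologicalSpace X] [MulAction G X]
    [ContinuousConstSMul G X] {H : ℕ → Subgroup G} {C : ℕ → Set G}
    (hC : ∀ n, IsCosetTransversal (H n) (C n)) {S : ℕ → Finset G}
    (hS : ∀ n, (S n : Set G) = H n) (𝒞 : Set (Set X))
    (h𝒞 : borel X = MeasurableSpace.generateFrom 𝒞)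
    (h : ∀ [MeasurableSpace X] [BorelSpace X] (μ : Measure X) [IsProbabilityMeasure μ],
      ∀ A ∈ 𝒞, HasZeroEntropyRate μ S (fun x => x ∈ A)) :
    topEntropy G X = 0 := by
  let _ : MeasurableSpace X := borel X
  have : BorelSpace X := ⟨rfl⟩
  have : MeasurableConstSMul G X := ⟨fun g => (continuous_const_smul g).measurable⟩
  rw [topEntropy]
  simp only [ENNReal.iSup_eq_zero, ksEntropy]
  intro μ _ _ m P hPm
  have hP : IsMeasurablePartition P := fun s => hPm (Set.toFinite s).measurableSet
  exact dynEntropy_eq_zero hC hS hP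
    (.of_mem hP fun i => .of_generateFrom h𝒞 (fun A hA => h μ A hA) (hP {i}))

/-! ### Finite permutations -/

namespace FinPerm

lemma toPerm_mul_apply (g h : FinPerm) (n : ℕ+) : (g * h).toPerm n = h.toPerm (g.toPerm n) := rfl

lemma toPerm_inv (g : FinPerm) : g⁻¹.toPerm = g.toPerm⁻¹ := rfl

lemma toPerm_injective : Function.Injective toPerm := fun _ _ h =>
  MulOpposite.unop_injective (Subtype.ext h)

end FinPerm

lemma finite_setOf_le (k : ℕ) : {n : ℕ+ | (n : ℕ) ≤ k}.Finite :=
  Set.Finite.preimage PNat.coe_injective.injOn (Set.finite_Iic k)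

/-- A permutation fixing all `n > k`, as an element of the group of finite permutations. -/
def permOfFix (k : ℕ) (f : Equiv.Perm ℕ+) (hf : ∀ n : ℕ+, k < (n : ℕ) → f n = n) : FinPerm :=
  MulOpposite.op ⟨f, (finite_setOf_le k).subset fun n hn => by
    by_contra h
    exact hn (hf n (not_le.1 h))⟩

lemma permOfFix_mem (k : ℕ) (f : Equiv.Perm ℕ+) (hf : ∀ n : ℕ+, k < (n : ℕ) → f n = n) :
    permOfFix k f hf ∈ symSet k := hf

/-- `symSet k` as a subgroup. -/
def symSubgroup (k : ℕ) : Subgroup FinPerm where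
  carrier := symSet k
  one_mem' := fun _ _ => rfl
  mul_mem' := by
    intro a b ha hb n hn
    rw [FinPerm.toPerm_mul_apply, ha n hn, hb n hn]
  inv_mem' := by
    intro a ha n hn
    rw [FinPerm.toPerm_inv, Equiv.Perm.inv_eq_iff_eq, ha n hn]

/-- `symSet k` is the symmetric group on `{1, …, k}`. -/
def symSetEquiv (k : ℕ) : symSet k ≃ Equiv.Perm {n : ℕ+ // (n : ℕ) ≤ k} :=
  Equiv.trans
    { toFun := fun g => ⟨g.1.toPerm, fun n hn => g.2 n (not_le.1 hn)⟩
      invFun := fun f => ⟨permOfFix k f.1 fun n hn => f.2 n (not_le.2 hn), permOfFix_mem _ _ _⟩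
      left_inv := fun _ => rfl
      right_inv := fun _ => rfl }
    (Equiv.Perm.subtypeEquivSubtypePerm fun n : ℕ+ => (n : ℕ) ≤ k).symm

/-- `i ↦ i + 1`, from `{0, …, k - 1}` to `{1, …, k}`. -/
def finEquivLe (k : ℕ) : Fin k ≃ {n : ℕ+ // (n : ℕ) ≤ k} where
  toFun i := ⟨⟨i + 1, Nat.succ_pos _⟩, i.2⟩
  invFun n := ⟨(n.1 : ℕ) - 1, by have := n.1.pos; have := n.2; omega⟩
  left_inv i := by ext; simp
  right_inv n := Subtype.ext (PNat.eq (Nat.sub_add_cancel n.1.pos))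

instance (k : ℕ) : Finite {n : ℕ+ // (n : ℕ) ≤ k} := Finite.of_equiv _ (finEquivLe k)

lemma finite_symSet (k : ℕ) : (symSet k).Finite :=
  Set.finite_coe_iff.1 (Finite.of_equiv _ (symSetEquiv k).symm)

/-- `symSet k` as a finset. -/
def symFinset (k : ℕ) : Finset FinPerm := (finite_symSet k).toFinset

lemma mem_symFinset {k : ℕ} {g : FinPerm} : g ∈ symFinset k ↔ g ∈ symSet k := by
  simp [symFinset]

lemma coe_symFinset (k : ℕ) : (symFinset k : Set FinPerm) = symSet k := by
  ext; simp [mem_symFinset]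

lemma card_symFinset (k : ℕ) : (symFinset k).card = k.factorial := by
  rw [← Set.ncard_coe_finset, coe_symFinset, ← Nat.card_coe_set_eq, Nat.card_congr (symSetEquiv k),
    Nat.card_perm, ← Nat.card_congr (finEquivLe k), Nat.card_fin]

lemma symSet_mono {k m : ℕ} (h : k ≤ m) : symSet k ⊆ symSet m :=
  fun _ hg n hn => hg n (h.trans_lt hn)

lemma eventually_mem_symSet (g : FinPerm) : ∀ᶠ k in atTop, g ∈ symSet k := by
  obtain ⟨M, hM⟩ := (Set.Finite.image (fun n : ℕ+ => (n : ℕ)) g.unop.2).bddAbove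
  filter_upwards [eventually_ge_atTop M] with k hk n hn
  by_contra h
  exact absurd (hM ⟨n, h, rfl⟩) (by simp only; omega)

instance : Countable FinPerm := by
  have h : (⋃ k, symSet k) = Set.univ := Set.eq_univ_of_forall fun g =>
    Set.mem_iUnion.2 (eventually_mem_symSet g).exists
  rw [← Set.countable_univ_iff, ← h]
  exact Set.countable_iUnion fun k => (finite_symSet k).countable

/-- The group is the increasing union of the finite subgroups S_k. Once S_k contains `K`, K S_k =
S_k and the symmetric difference is empty. -/
lemma isFolner_symFinset {τ : ℕ → ℕ} (hτ : Tendsto τ atTop atTop) :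
    IsFolner fun j => symFinset (τ j) := by
  intro K hK ε hε
  have hev : ∀ᶠ k in atTop, ∀ g ∈ K, g ∈ symSet k :=
    (Finset.eventually_all K).2 fun g _ => eventually_mem_symSet g
  filter_upwards [hτ.eventually hev] with j hj
  have h1 : (1 : FinPerm) ∈ symSet (τ j) := (symSubgroup (τ j)).one_mem
  refine ⟨⟨1, mem_symFinset.2 h1⟩, ?_⟩
  have hmul : (K : Set FinPerm) * (symFinset (τ j) : Set FinPerm) = symFinset (τ j) := by
    rw [coe_symFinset]
    apply Set.Subset.antisymm
    · rintro _ ⟨g, hg, s, hs, rfl⟩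
      exact (symSubgroup (τ j)).mul_mem (hj g hg) hs
    · intro s hs
      obtain ⟨g, hg⟩ := hK
      exact ⟨g, hg, g⁻¹ * s, (symSubgroup (τ j)).mul_mem
        ((symSubgroup (τ j)).inv_mem (hj g hg)) hs, mul_inv_cancel_left g s⟩
  rw [hmul, symmDiff_self]
  simpa using hε.le

/-! ### The sets of increasing permutations -/

lemma toPerm_le_of_mem_symSet {k : ℕ} {s : FinPerm} (hs : s ∈ symSet k) {n : ℕ+}
    (hn : (n : ℕ) ≤ k) : (s.toPerm n : ℕ) ≤ k := by
  by_contra h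
  have := s.toPerm.injective (hs _ (not_le.1 h))
  rw [this] at h
  exact h hn

/-- `s * c` is c ∘ s, `s` maps {1, …, n} into itself, and `c` preserves and reflects the order
there. -/
lemma mul_mem_incrSet_iff {k n : ℕ} (hk : k ≤ n) {s c : FinPerm} (hs : s ∈ symSet n)
    (hc : c ∈ incrSet n) : s * c ∈ incrSet k ↔ s ∈ incrSet k := by
  have hlt : ∀ a b : ℕ+, (a : ℕ) ≤ n → (b : ℕ) ≤ n → (c.toPerm a < c.toPerm b ↔ a < b) := by
    intro a b ha hb
    refine ⟨fun h => ?_, fun h => hc a b h hb⟩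
    by_contra hab
    rcases eq_or_lt_of_le (not_lt.1 hab) with rfl | hba
    · exact lt_irrefl _ h
    · exact lt_asymm h (hc b a hba ha)
  refine forall₄_congr fun i j hij hj => ?_
  have hij' : (i : ℕ) ≤ j := by exact_mod_cast hij.le
  rw [FinPerm.toPerm_mul_apply, FinPerm.toPerm_mul_apply]
  exact hlt _ _ (toPerm_le_of_mem_symSet hs (by omega)) (toPerm_le_of_mem_symSet hs (by omega))

/-- Such an `s` is strictly increasing everywhere, and a well-order has no order automorphism but
the identity. -/
lemma eq_one_of_mem_incrSet {k : ℕ} {s : FinPerm} (hs : s ∈ symSet k) (hs' : s ∈ incrSet k) :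
    s = 1 := by
  have hmono : StrictMono s.toPerm := by
    intro i j hij
    by_cases hj : (j : ℕ) ≤ k
    · exact hs' i j hij hj
    · rw [hs j (not_le.1 hj)]
      by_cases hi : (i : ℕ) ≤ k
      · rw [← PNat.coe_lt_coe]
        exact (toPerm_le_of_mem_symSet hs hi).trans_lt (not_le.1 hj)
      · rwa [hs i (not_le.1 hi)]
  have h : StrictMono.orderIsoOfSurjective _ hmono s.toPerm.surjective = OrderIso.refl ℕ+ :=
    Subsingleton.elim _ _
  refine FinPerm.toPerm_injective (Equiv.ext fun n => ?_)
  exact DFunLike.congr_fun h n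

lemma isCosetTransversal_incrSet (k : ℕ) : IsCosetTransversal (symSubgroup k) (incrSet k) := by
  intro g
  set f : Fin k → ℕ+ := fun i => g.toPerm (finEquivLe k i) with hf
  have hfinj : Function.Injective f :=
    g.toPerm.injective.comp (Subtype.val_injective.comp (finEquivLe k).injective)
  -- The permutation sorting g(1), …, g(k), extended by the identity beyond k.
  set σ := Tuple.sort f
  have hσ : StrictMono (f ∘ σ) :=
    (Tuple.monotone_sort f).strictMono_of_injective (hfinj.comp σ.injective)
  set s := permOfFix k (σ.extendDomain (finEquivLe k)) fun n hn =>
    Equiv.Perm.extendDomain_apply_not_subtype _ _ (not_le.2 hn) with hsdef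
  have hs : s ∈ symSubgroup k := permOfFix_mem _ _ _
  have hval : ∀ i : Fin k, (s * g).toPerm (finEquivLe k i) = f (σ i) := fun i =>
    congrArg g.toPerm (Equiv.Perm.extendDomain_apply_image σ (finEquivLe k) i)
  have hinc : s * g ∈ incrSet k := by
    intro i j hij hj
    have hij' : (i : ℕ) < j := by exact_mod_cast hij
    obtain ⟨i', hi'⟩ := (finEquivLe k).surjective ⟨i, by omega⟩
    obtain ⟨j', hj'⟩ := (finEquivLe k).surjective ⟨j, hj⟩
    have hi := hval i'
    have hj := hval j'
    rw [hi'] at hi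
    rw [hj'] at hj
    rw [hi, hj]
    apply hσ
    have h1 := congrArg (fun n => ((n.1 : ℕ+) : ℕ)) hi'
    have h2 := congrArg (fun n => ((n.1 : ℕ+) : ℕ)) hj'
    simp only [finEquivLe, Equiv.coe_fn_mk, PNat.mk_coe] at h1 h2
    rw [Fin.lt_def]
    omega
  refine ⟨s * g, ⟨hinc, s⁻¹, (symSubgroup k).inv_mem hs, (inv_mul_cancel_left s g).symm⟩, ?_⟩
  · rintro c ⟨hc, t, ht, hg⟩
    -- If g = t c, then s g = (s t) c with both s g and c increasing on {1, …, k}; self-similarity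
    -- at n = k puts s t in C_k ∩ S_k = {1}.
    have hst : s * t ∈ symSubgroup k := (symSubgroup k).mul_mem hs ht
    have hsg : s * g = s * t * c := by rw [hg, mul_assoc]
    rw [hsg] at hinc ⊢
    rw [eq_one_of_mem_incrSet hst ((mul_mem_incrSet_iff le_rfl hst hc).1 hinc), one_mul]

/-! ### Topology of the full shift -/

section Shift

variable {G A : Type*}

instance [Finite A] : CompactSpace (Shift G A) :=
  let _ : TopologicalSpace A := ⊥
  inferInstanceAs (CompactSpace (G → A))

instance : T2Space (Shift G A) :=
  let _ : TopologicalSpace A := ⊥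
  have : DiscreteTopology A := ⟨rfl⟩
  inferInstanceAs (T2Space (G → A))

lemma isClopen_preimage_eval (h : G) (s : Set A) : IsClopen {x : Shift G A | x h ∈ s} := by
  let _ : TopologicalSpace A := ⊥
  have : DiscreteTopology A := ⟨rfl⟩
  exact (isClopen_discrete s).preimage (continuous_apply (A := fun _ : G => A) h)

instance [Group G] : ContinuousConstSMul G (Shift G A) where
  continuous_const_smul g := by
    let _ : TopologicalSpace A := ⊥
    exact continuous_pi fun h => continuous_apply (A := fun _ : G => A) (h * g)

end Shift

/-! ### Spaces separated by countably many clopen sets -/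

section Separating

variable {X ι : Type*} [TopologicalSpace X] {U : ι → Set X}

lemma isClosedEmbedding_boolIndicator [CompactSpace X] (hU : ∀ i, IsClopen (U i))
    (hsep : ∀ x y, (∀ i, x ∈ U i ↔ y ∈ U i) → x = y) :
    IsClosedEmbedding fun x i => (U i).boolIndicator x := by
  refine Continuous.isClosedEmbedding
    (continuous_pi fun i => (continuous_boolIndicator_iff_isClopen _).2 (hU i)) fun x y h => ?_
  refine hsep x y fun i => ?_
  rw [Set.mem_iff_boolIndicator, Set.mem_iff_boolIndicator, congrFun h i]

lemma metrizableSpace_of_separating [CompactSpace X] [Countable ι] (hU : ∀ i, IsClopen (U i))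
    (hsep : ∀ x y, (∀ i, x ∈ U i ↔ y ∈ U i) → x = y) : TopologicalSpace.MetrizableSpace X :=
  have : TopologicalSpace.MetrizableSpace (ι → Bool) :=
    TopologicalSpace.metrizableSpace_of_t3_secondCountable _
  (isClosedEmbedding_boolIndicator hU hsep).isEmbedding.metrizableSpace

lemma borel_eq_generateFrom_of_separating [CompactSpace X] [Countable ι]
    (hU : ∀ i, IsClopen (U i)) (hsep : ∀ x y, (∀ i, x ∈ U i ↔ y ∈ U i) → x = y) :
    borel X = MeasurableSpace.generateFrom (Set.range U) := by
  apply le_antisymm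
  · have h : borel X = (borel (ι → Bool)).comap fun x i => (U i).boolIndicator x :=
      (congrArg (@borel X) (isClosedEmbedding_boolIndicator hU hsep).isInducing.eq_induced).trans
        borel_comap
    rw [h, ← BorelSpace.measurable_eq (α := ι → Bool), ← measurable_iff_comap_le]
    refine @measurable_pi_lambda _ _ _ (_) _ _ fun i => ?_
    refine @measurable_to_bool _ (_) _ ?_
    convert MeasurableSpace.measurableSet_generateFrom (Set.mem_range_self i)
    ext x
    exact (Set.mem_iff_boolIndicator _ _).symm
  · refine MeasurableSpace.generateFrom_le ?_
    rintro _ ⟨i, rfl⟩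
    let _ : MeasurableSpace X := borel X
    have : BorelSpace X := ⟨rfl⟩
    exact (hU i).isOpen.measurableSet

end Separating

/-! ### The system of monotilings -/

/-- The single shape at level `n` is `symSet (n + 2)`. -/
def symShapes (n : ℕ) : Finset (Finset FinPerm) := {symFinset (n + 2)}

instance (n : ℕ) : Unique (symShapes n) where
  default := ⟨symFinset (n + 2), Finset.mem_singleton_self _⟩
  uniq S := Subtype.ext (Finset.mem_singleton.1 S.2)

lemma coe_symShapes {n : ℕ} (S : symShapes n) : ((S : Finset FinPerm) : Set FinPerm) =
    symSubgroup (n + 2) := by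
  rw [Finset.mem_singleton.1 S.2, coe_symFinset]
  rfl

lemma eq_some_iff_ne_none {n : ℕ} (o : Option (symShapes n)) (S : symShapes n) :
    o = some S ↔ o ≠ none := by
  rw [Option.ne_none_iff_exists', Unique.exists_iff, Subsingleton.elim S default]

open scoped Classical in
/-- The monotiling with shape `symSet (n + 2)` and set of centers `incrSet (n + 2)`. -/
def incrTiling (n : ℕ) : Symbolic (symShapes n) :=
  fun c => if c ∈ incrSet (n + 2) then some default else none

lemma incrTiling_ne_none {n : ℕ} {c : FinPerm} :
    incrTiling n c ≠ none ↔ c ∈ incrSet (n + 2) := by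
  simp [incrTiling]

/-- The orbit closure of the sequence of the monotilings `incrTiling n`. -/
def incrTilingSpace : SubMulAction FinPerm (∀ n, Symbolic (symShapes n)) where
  carrier := closure (MulAction.orbit FinPerm incrTiling)
  smul_mem' g _ hx := map_mem_closure (continuous_const_smul g) hx fun _ hy =>
    MulAction.mem_orbit_of_mem_orbit g hy

lemma incrTiling_mem_space : incrTiling ∈ incrTilingSpace :=
  subset_closure (MulAction.mem_orbit_self _)

lemma isClosed_incrTilingSpace :
    IsClosed (incrTilingSpace : Set (∀ n, Symbolic (symShapes n))) := isClosed_closure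

/-- Fixing finitely many coordinates is an open condition, so some point of the orbit satisfies it.
Statements involving finitely many coordinates thus reduce to statements about the sets C_k. -/
lemma exists_agree {x : ∀ n, Symbolic (symShapes n)} (hx : x ∈ incrTilingSpace)
    {W : Set (ℕ × FinPerm)} (hW : W.Finite) :
    ∃ g, ∀ w ∈ W, x w.1 w.2 ≠ none ↔ w.2 * g ∈ incrSet (w.1 + 2) := by
  have hopen : IsOpen (⋂ w ∈ W, {y : ∀ n, Symbolic (symShapes n) | y w.1 w.2 ∈
      ({x w.1 w.2} : Set (Option (symShapes w.1)))}) :=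
    hW.isOpen_biInter fun w _ =>
      (isClopen_preimage_eval w.2 {x w.1 w.2}).isOpen.preimage
        (continuous_apply (A := fun n => Symbolic (symShapes n)) w.1)
  obtain ⟨_, hy, g, rfl⟩ := mem_closure_iff.1 hx _ hopen (by simp)
  refine ⟨g, fun w hw => ?_⟩
  have h : (g • incrTiling) w.1 w.2 = x w.1 w.2 := Set.mem_iInter₂.1 hy w hw
  rw [← h]
  exact incrTiling_ne_none

lemma isProperTiling_of_mem {x : ∀ n, Symbolic (symShapes n)} (hx : x ∈ incrTilingSpace) (n : ℕ) :
    IsProperTiling (x n) := by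
  constructor
  · intro S hS
    rw [← Finset.mem_coe, coe_symShapes ⟨S, hS⟩]
    exact (symSubgroup _).one_mem
  · intro a
    -- The center of a tile containing `a` lies in S_{n+2} a, so this finite window decides
    -- existence and uniqueness.
    have hfin : ((fun s => (n, s * a)) '' symSet (n + 2)).Finite := (finite_symSet _).image _
    obtain ⟨g, hg⟩ := exists_agree hx hfin
    have key : ∀ c, (∃ S : symShapes n, x n c = some S ∧
        a ∈ translate ((S : Finset FinPerm) : Set FinPerm) c) ↔
        c * g ∈ incrSet (n + 2) ∧ ∃ s ∈ symSubgroup (n + 2), a * g = s * (c * g) := by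
      intro c
      rw [Unique.exists_iff, eq_some_iff_ne_none, coe_symShapes]
      constructor
      · rintro ⟨h1, s, hs, rfl⟩
        refine ⟨(hg (n, c) ⟨s⁻¹, (symSubgroup _).inv_mem hs, ?_⟩).1 h1, s, hs, mul_assoc _ _ _⟩
        simp
      · rintro ⟨h1, s, hs, h2⟩
        rw [← mul_assoc, mul_left_inj] at h2
        subst h2
        exact ⟨(hg (n, c) ⟨s⁻¹, (symSubgroup _).inv_mem hs, by simp⟩).2 h1, s, hs, rfl⟩
    obtain ⟨c, hc, huniq⟩ := isCosetTransversal_incrSet (n + 2) (a * g)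
    refine ⟨c * g⁻¹, (key _).2 (by simpa using hc), fun d hd => ?_⟩
    rw [← huniq _ ((key d).1 hd), mul_inv_cancel_right]

/-- The system of monotilings generated by the sets `incrSet k`, `k ≥ 2`. -/
def incrTilingSystem : TilingSystem FinPerm where
  shapes := symShapes
  dyn n :=
    { carrier := (fun x : ∀ n, Symbolic (symShapes n) => x n) '' incrTilingSpace
      smul_mem' := by
        rintro g _ ⟨x, hx, rfl⟩
        exact ⟨g • x, incrTilingSpace.smul_mem g hx, rfl⟩ }
  isDynamicalTiling n := by
    refine ⟨(isClosed_incrTilingSpace.isCompact.image (continuous_apply n)).isClosed, ?_⟩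
    rintro _ ⟨x, hx, rfl⟩
    exact isProperTiling_of_mem hx n
  space := incrTilingSpace
  isClosed_space := isClosed_incrTilingSpace
  image_space _ := rfl

lemma mem_tiles_iff {n : ℕ} {x : Symbolic (symShapes n)} {T : Set FinPerm} :
    T ∈ tiles x ↔ ∃ c, x c ≠ none ∧ T = translate (symSubgroup (n + 2)) c := by
  refine exists_congr fun c => ?_
  rw [Unique.exists_iff, eq_some_iff_ne_none, coe_symShapes]

lemma isFolnerSystem_incrTilingSystem : incrTilingSystem.IsFolnerSystem := by
  have hrange : {S : Finset FinPerm | ∃ n, S ∈ incrTilingSystem.shapes n} =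
      Set.range fun n => symFinset (n + 2) := by
    ext S
    refine exists_congr fun n => ?_
    rw [eq_comm]
    exact Finset.mem_singleton
  have hinj : Function.Injective fun n => symFinset (n + 2) := by
    intro m n h
    have := congrArg Finset.card h
    simp only [card_symFinset] at this
    -- The shift by 2 avoids the coincidence 0! = 1!.
    have := (Nat.factorial_inj (by omega)).1 this
    omega
  rw [TilingSystem.IsFolnerSystem, hrange]
  refine ⟨Set.infinite_range_of_injective hinj, fun F hF hFr => ?_⟩
  have hmem : ∀ j, ∃ n, symFinset (n + 2) = F j := fun j => by
    have : F j ∈ Set.range F := ⟨j, rfl⟩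
    rwa [hFr] at this
  choose τ hτ using hmem
  have hτinj : Function.Injective τ := fun i j h => hF (by rw [← hτ, ← hτ, h])
  -- An injective sequence of natural numbers tends to infinity, so the order of enumeration is
  -- irrelevant.
  have hlim : Tendsto (fun j => τ j + 2) atTop atTop := by
    have := hτinj.tendsto_cofinite
    rw [Nat.cofinite_eq_atTop] at this
    exact tendsto_atTop_mono (fun j => Nat.le_add_right _ _) this
  rw [show F = fun j => symFinset (τ j + 2) from funext fun j => (hτ j).symm]
  exact isFolner_symFinset hlim

lemma isUniquelyCongruent_incrTilingSystem : incrTilingSystem.IsUniquelyCongruent := by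
  constructor
  · intro x hx n T hT
    obtain ⟨c, -, rfl⟩ := mem_tiles_iff.1 hT
    refine ⟨{U ∈ tiles (x n) | U ⊆ translate (symSubgroup (n + 1 + 2)) c}, fun U hU => hU.1,
      Set.Subset.antisymm ?_ (Set.sUnion_subset fun U hU => hU.2)⟩
    rintro _ ⟨s, hs, rfl⟩
    obtain ⟨d, ⟨S, hd, ht⟩, -⟩ := (isProperTiling_of_mem hx n).2 (s * c)
    rw [coe_symShapes] at ht
    refine ⟨translate (symSubgroup (n + 2)) d,
      ⟨mem_tiles_iff.2 ⟨d, (eq_some_iff_ne_none _ _).1 hd, rfl⟩, ?_⟩, ht⟩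
    obtain ⟨t, ht, h⟩ := ht
    rintro _ ⟨u, hu, rfl⟩
    -- Cosets of S_{n+2} meeting a coset of the larger subgroup S_{n+3} lie inside it: u d = u t⁻¹
    -- (t d) = u t⁻¹ s c.
    refine ⟨u * t⁻¹ * s, (symSubgroup _).mul_mem ?_ hs, ?_⟩
    · exact symSet_mono (by omega) ((symSubgroup _).mul_mem hu ((symSubgroup _).inv_mem ht))
    · simp only at h ⊢
      rw [mul_assoc, ← h, mul_assoc, inv_mul_cancel_left]
  · intro x hx x' hx' n S' c c' hc hc' T hT hsub
    obtain ⟨d, hd, rfl⟩ := mem_tiles_iff.1 hT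
    have hc := (eq_some_iff_ne_none _ _).1 hc
    have hc' := (eq_some_iff_ne_none _ _).1 hc'
    -- The center of `T` belongs to `T`, hence has the form s c with s ∈ S_{n+3}. By self-similarity
    -- it is a center iff s ∈ C_{n+2}, a condition that involves neither `x` nor `c`.
    obtain ⟨s, hs, rfl⟩ := hsub.trans_eq
      (congrArg (translate · c) (coe_symShapes (n := n + 1) S')) ⟨1, (symSubgroup _).one_mem, one_mul d⟩
    refine mem_tiles_iff.2 ⟨s * c', ?_, ?_⟩
    · obtain ⟨g, hg⟩ := exists_agree hx (W := {(n + 1, c), (n, s * c)}) (Set.toFinite _)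
      obtain ⟨g', hg'⟩ := exists_agree hx' (W := {(n + 1, c'), (n, s * c')}) (Set.toFinite _)
      have h1 := (hg (n + 1, c) (by simp)).1 hc
      have h2 := (hg (n, s * c) (by simp)).1 hd
      have h1' := (hg' (n + 1, c') (by simp)).1 hc'
      refine (hg' (n, s * c') (by simp)).2 ?_
      simp only [mul_assoc] at h2 ⊢
      exact (mul_mem_incrSet_iff (by omega) hs h1').2
        ((mul_mem_incrSet_iff (by omega) hs h1).1 h2)
    · rw [translate, translate, translate, Set.image_image]
      exact Set.image_congr fun u _ => by group

/-- The set of the points of the orbit closure whose `n`th tiling has a tile centered at `h`. -/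
def centerSet (i : ℕ × FinPerm) : Set incrTilingSpace := {x | x.1 i.1 i.2 ≠ none}

lemma isClopen_centerSet (i : ℕ × FinPerm) : IsClopen (centerSet i) :=
  (isClopen_preimage_eval i.2 {none}ᶜ).preimage
    ((continuous_apply i.1).comp continuous_subtype_val)

lemma eq_of_centerSet (x y : incrTilingSpace) (h : ∀ i, x ∈ centerSet i ↔ y ∈ centerSet i) :
    x = y := by
  refine Subtype.ext (funext fun n => funext fun c => ?_)
  have hxy : x.1 n c ≠ none ↔ y.1 n c ≠ none := h (n, c)
  by_cases hx : x.1 n c = none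
  · rw [hx, eq_comm]
    by_contra hy
    exact hxy.2 hy hx
  · rw [(eq_some_iff_ne_none _ default).2 hx, (eq_some_iff_ne_none _ default).2 (hxy.1 hx)]

instance : CompactSpace incrTilingSpace :=
  isCompact_iff_compactSpace.1 isClosed_incrTilingSpace.isCompact

instance : TopologicalSpace.MetrizableSpace incrTilingSpace :=
  metrizableSpace_of_separating isClopen_centerSet eq_of_centerSet

instance : ContinuousConstSMul FinPerm incrTilingSpace where
  continuous_const_smul g :=
    ((continuous_const_smul g).comp continuous_subtype_val).subtype_mk _

/-- At most N! patterns occur on the window S_N, which has N! elements; apply log m = o(m) with m =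
N!. -/
lemma hasZeroEntropyRate_centerSet [MeasurableSpace incrTilingSpace] [BorelSpace incrTilingSpace]
    (μ : Measure incrTilingSpace) [IsProbabilityMeasure μ] (i : ℕ × FinPerm) :
    HasZeroEntropyRate μ symFinset (fun x => x ∈ centerSet i) := by
  classical
  have : MeasurableConstSMul FinPerm incrTilingSpace :=
    ⟨fun g => (continuous_const_smul g).measurable⟩
  have hP : IsMeasurablePartition (fun x => x ∈ centerSet i) :=
    isMeasurablePartition_mem (isClopen_centerSet i).isOpen.measurableSet
  intro ε hε
  have hlim : Tendsto (fun N => ((symFinset N).card : ℝ)) atTop atTop := by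
    refine tendsto_natCast_atTop_atTop.comp (tendsto_atTop_mono (fun N => ?_) tendsto_id)
    rw [card_symFinset]
    exact Nat.self_le_factorial N
  filter_upwards [hlim.eventually (Real.isLittleO_log_id_atTop.bound hε),
    eventually_mem_symSet i.2, eventually_ge_atTop (i.1 + 2)] with N hlog hiN hN
  have hpos : (0 : ℝ) < (symFinset N).card := by
    rw [card_symFinset]; exact_mod_cast Nat.factorial_pos N
  have hlog' : Real.log (symFinset N).card ≤ ε * (symFinset N).card := by
    refine (le_abs_self _).trans (hlog.trans_eq ?_)
    simp
  refine le_trans ?_ hlog'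
  set V : Finset (symFinset N → Prop) :=
    (symFinset N).image fun t s => i.2 * s * t ∈ incrSet (i.1 + 2) with hVdef
  have hV : ∀ x, refine (fun x => x ∈ centerSet i) (symFinset N) x ∈ V := by
    intro x
    obtain ⟨g, hg⟩ := exists_agree x.2
      (W := (fun s => (i.1, i.2 * s)) '' symSet N) ((finite_symSet N).image _)
    -- Write g = t c with c ∈ C_N. For s ∈ S_N and N so large that h = `i.2` is in S_N, h s g = (h s
    -- t) c has its first factor in S_N, so membership in C_{i.1+2} depends on `t` only.
    obtain ⟨c, ⟨hc, t, ht, rfl⟩, -⟩ := isCosetTransversal_incrSet N g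
    refine Finset.mem_image.2 ⟨t, mem_symFinset.2 ht, funext fun s => propext ?_⟩
    have hs := mem_symFinset.1 s.2
    have h1 : ((s : FinPerm) • x) ∈ centerSet i ↔ x.1 i.1 (i.2 * s) ≠ none := Iff.rfl
    have hmem : i.2 * s * t ∈ symSubgroup N :=
      (symSubgroup N).mul_mem ((symSubgroup N).mul_mem hiN hs) ht
    rw [← mul_mem_incrSet_iff hN hmem hc, mul_assoc (i.2 * (s : FinPerm)) t c]
    exact ((h1.trans (hg (i.1, i.2 * s) ⟨s, hs, rfl⟩))).symm
  have hVpos : 0 < V.card :=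
    Finset.card_pos.2 (Finset.Nonempty.image (Finset.card_pos.1 (by exact_mod_cast hpos)) _)
  refine (refineEntropy_le_log_card hP _ V hV).trans
    (Real.log_le_log (by exact_mod_cast hVpos) ?_)
  exact_mod_cast Finset.card_image_le

lemma topEntropy_incrTilingSpace : topEntropy FinPerm incrTilingSpace = 0 := by
  refine topEntropy_eq_zero isCosetTransversal_incrSet (S := symFinset) coe_symFinset
    (Set.range centerSet) (borel_eq_generateFrom_of_separating isClopen_centerSet eq_of_centerSet)
    ?_
  rintro _ _ μ _ _ ⟨i, rfl⟩
  exact hasZeroEntropyRate_centerSet μ i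

open scoped Classical in
lemma stronglyDeterministicSet_incrSet (n : ℕ) : StronglyDeterministicSet (incrSet (n + 2)) := by
  -- The function φ reads the coordinate at the unit: (g x)(1) = x(g).
  refine ⟨incrTilingSpace, inferInstance, inferInstance, inferInstance, inferInstance,
    inferInstance, topEntropy_incrTilingSpace, (centerSet (n, 1)).indicator fun _ => 1,
    ⟨incrTiling, incrTiling_mem_space⟩,
    (isClopen_centerSet _).continuous_indicator continuous_const, fun g => ?_⟩
  have h : g • (⟨incrTiling, incrTiling_mem_space⟩ : incrTilingSpace) ∈ centerSet (n, 1) ↔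
      g ∈ incrSet (n + 2) := by
    have : g • (⟨incrTiling, incrTiling_mem_space⟩ : incrTilingSpace) ∈ centerSet (n, 1) ↔
      incrTiling n (1 * g) ≠ none := Iff.rfl
    rw [this, incrTiling_ne_none, one_mul]
  rw [Set.indicator_apply, Set.indicator_apply]
  simp only [h]

lemma hasBanachDensity_incrSet (k : ℕ) : HasBanachDensity (incrSet k) (1 / (k.factorial : ℝ)) := by
  rw [← card_symFinset k]
  exact hasBanachDensity_of_transversal (isCosetTransversal_incrSet k) (coe_symFinset k)
    (isFolner_symFinset tendsto_id)

end Determinism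

end

theorem mainTheorem11 :
    (∀ k : ℕ, 2 ≤ k →
      Determinism.StronglyDeterministicSet (Determinism.incrSet k) ∧
      Determinism.HasBanachDensity (Determinism.incrSet k) (1 / (Nat.factorial k : ℝ))) ∧
    ∃ (Θ : Determinism.TilingSystem Determinism.FinPerm)
      (𝒯 : ∀ n, Determinism.Symbolic (Θ.shapes n)),
      (Θ.space : Set (∀ n, Determinism.Symbolic (Θ.shapes n))) =
        closure (MulAction.orbit Determinism.FinPerm 𝒯) ∧
      𝒯 ∈ Θ.space ∧
      (∀ n, ∃ S : Finset Determinism.FinPerm,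
        Θ.shapes n = {S} ∧ (S : Set Determinism.FinPerm) = Determinism.symSet (n + 2)) ∧
      (∀ n, Determinism.centers (𝒯 n) = Determinism.incrSet (n + 2)) ∧
      Θ.IsMono ∧
      Θ.IsFolnerSystem ∧
      Θ.IsUniquelyCongruent ∧
      Determinism.topEntropy Determinism.FinPerm Θ.space = 0 := by
  refine ⟨fun k hk => ?_, Determinism.incrTilingSystem, Determinism.incrTiling, rfl,
    Determinism.incrTiling_mem_space, fun n => ⟨Determinism.symFinset (n + 2), rfl,
      Determinism.coe_symFinset _⟩, fun n => ?_, fun n => Finset.card_singleton _,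
    Determinism.isFolnerSystem_incrTilingSystem,
    Determinism.isUniquelyCongruent_incrTilingSystem, Determinism.topEntropy_incrTilingSpace⟩
  · obtain ⟨n, rfl⟩ := Nat.exists_eq_add_of_le' hk
    exact ⟨Determinism.stronglyDeterministicSet_incrSet n, Determinism.hasBanachDensity_incrSet _⟩
  · ext c
    exact Determinism.incrTiling_ne_none
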